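/- Let $n, N, m \ge 1$ be integers. Write $X=(x,\xi)\in\mathbb{R}^{n}\times\mathbb{R}^n=\mathbb{R}^{2n}$, $|X|$ for the Euclidean norm, $\langle X\rangle=(1+|X|^2)^{1/2}$, and $\sigma((x,\xi),(y,\eta))=\xi\cdot y-x\cdot\eta$ for the canonical symplectic form. Let $q_1,\dots,q_N:\mathbb{R}^{2n}\to\mathbb{C}$ be complex-valued quadratic forms with $\mathrm{Re}\,q_j(X)\ge 0$ for all $X\in\mathbb{R}^{2n}$ and all $1\le j\le N$. Let $F_j\in M_{2n}(\mathbb{C})$ be the Hamilton map of $q_j$, i.e. the unique matrix with $q_j(X;Y)=\sigma(X,F_jY)$ for all $X,Y\in\mathbb{R}^{2n}$, where $q_j(\cdot\,;\cdot)$ is the polarized (symmetric bilinear) form of $q_j$, and let $\mathrm{Im}\,F_j=\frac{1}{2i}(F_j-\overline{F_j})$. Let $\Omega_0$ be an open subset of $\mathbb{R}^{2n}$, and suppose that there is $c_0>0$ such that $$\sum_{k=0}^{m}\ \sum_{\substack{1\le j\le N\\ (l_1,\dots,l_k)\in\{1,\dots,N\}^k}}\mathrm{Re}\,q_j\big(\mathrm{Im}\,F_{l_1}\cdots\mathrm{Im}\,F_{l_k}X\big)\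 \ge\ c_0|X|^2\qquad\text{for all }X\in\Omega_0,$$ where the term with $k=0$ is $\sum_{j=1}^N\mathrm{Re}\,q_j(X)$. Then there exist $N$ real-valued functions $g_1,\dots,g_N$ in the symbol class $S_{\Omega_0}\big(1,\langle X\rangle^{-\frac{2}{2m+1}}dX^2\big)$, that is, $g_j\in C^\infty(\Omega_0)$ and for every $\alpha\in\mathbb{N}^{2n}$ there is $C_\alpha>0$ with $|\partial_X^\alpha g_j(X)|\le C_\alpha\langle X\rangle^{-\frac{|\alpha|}{2m+1}}$ for all $X\in\Omega_0$, and there exist positive constants $c,c_1,\dots,c_N$ such that $$1+\sum_{j=1}^N\big(\mathrm{Re}\,q_j(X)+c_j\,H_{\mathrm{Im}\,q_j}\,g_j(X)\big)\ \ge\ c\,\langle X\rangle^{\frac{2}{2m+1}}\qquad\text{for all }X\in\Omega_0,$$ where $H_f=\frac{\partial f}{\partial\xi}\cdot\frac{\partial}{\partial x}-\frac{\partial f}{\partial x}\cdot\frac{\partial}{\partial\xi}$ denotes the Hamilton vector field of $f$. -/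

import Mathlib

open scoped ContDiff

noncomputable section

namespace QuadSys

/-- The phase space `ℝⁿ_x × ℝⁿ_ξ = ℝ²ⁿ` with its Euclidean norm: `X (Sum.inl i)` is the coordinate
`x_i` and `X (Sum.inr i)` is the coordinate `ξ_i`. -/
abbrev Phase (n : ℕ) : Type := EuclideanSpace ℝ (Fin n ⊕ Fin n)

/-- The `k`-th vector of the canonical basis of the phase space. -/
def basisVec {n : ℕ} (k : Fin n ⊕ Fin n) : Phase n := EuclideanSpace.single k (1 : ℝ)

/-- The Japanese bracket `⟨X⟩ = (1 + |X|²)^{1/2}`. -/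
def japaneseBracket {n : ℕ} (X : Phase n) : ℝ := Real.sqrt (1 + ‖X‖ ^ 2)

/-- A complex-valued quadratic form on the (real) phase space. -/
abbrev CQuadForm (n : ℕ) : Type := QuadraticMap ℝ (Phase n) ℂ

/-- The polarized form `q(X;Y)`: the symmetric `ℝ`-bilinear form with `q(X;X) = q(X)`. -/
def polarized {n : ℕ} (q : CQuadForm n) (X Y : Phase n) : ℂ :=
  (2 : ℂ)⁻¹ * (q (X + Y) - q X - q Y)

/-- The canonical symplectic form `σ((x,ξ),(y,η)) = ξ·y - x·η`, extended bilinearly to `ℂ²ⁿ`. -/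
def symplecticForm {n : ℕ} (X Y : Fin n ⊕ Fin n → ℂ) : ℂ :=
  ∑ i : Fin n, (X (Sum.inr i) * Y (Sum.inl i) - X (Sum.inl i) * Y (Sum.inr i))

/-- The inclusion of `ℝ²ⁿ` in `ℂ²ⁿ`. -/
def complexify {n : ℕ} (X : Phase n) : Fin n ⊕ Fin n → ℂ := fun k => (X k : ℂ)

/-- The Hamilton map `F ∈ M_{2n}(ℂ)` of `q`, written out in the canonical basis; it is characterized
by `q(X;Y) = σ(X, F Y)`, see `polarized_eq_symplecticForm` and `eq_hamiltonMap`. -/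
def hamiltonMap {n : ℕ} (q : CQuadForm n) : Matrix (Fin n ⊕ Fin n) (Fin n ⊕ Fin n) ℂ :=
  Matrix.of fun k l =>
    match k with
    | Sum.inl i => polarized q (basisVec (Sum.inr i)) (basisVec l)
    | Sum.inr i => -polarized q (basisVec (Sum.inl i)) (basisVec l)

/-- `Im F = (F - F̄)/(2i)`, a matrix with real entries, acting on the real phase space. -/
def imHamiltonMap {n : ℕ} (q : CQuadForm n) : Module.End ℝ (Phase n) :=
  Matrix.toEuclideanLin ((hamiltonMap q).map Complex.im)

/-- The product `Im F_{l_1} ⋯ Im F_{l_k}` (the identity when `k = 0`). -/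
def imHamiltonProd {n N : ℕ} (q : Fin N → CQuadForm n) {k : ℕ} (l : Fin k → Fin N) :
    Module.End ℝ (Phase n) :=
  (List.ofFn fun i => imHamiltonMap (q (l i))).prod

/-- The quadratic form
`∑_{k=0}^m ∑_{j, (l_1,…,l_k)} Re q_j (Im F_{l_1} ⋯ Im F_{l_k} X)`. -/
def iteratedSum {n N : ℕ} (q : Fin N → CQuadForm n) (m : ℕ) (X : Phase n) : ℝ :=
  ∑ k ∈ Finset.range (m + 1), ∑ j : Fin N, ∑ l : Fin k → Fin N,
    (q j (imHamiltonProd q l X)).re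

/-- The Hamilton vector field of `f` applied to `g`:
`H_f g = ∂_ξ f · ∂_x g - ∂_x f · ∂_ξ g`. -/
def hamiltonField {n : ℕ} (f g : Phase n → ℝ) (X : Phase n) : ℝ :=
  ∑ i : Fin n,
    (fderiv ℝ f X (basisVec (Sum.inr i)) * fderiv ℝ g X (basisVec (Sum.inl i)) -
      fderiv ℝ f X (basisVec (Sum.inl i)) * fderiv ℝ g X (basisVec (Sum.inr i)))

/-- The class of real-valued symbols `S_Ω(w^r, w^{-2s} dX²)` on an open set `Ω`: smooth functions
on `Ω` all of whose derivatives of order `k` are `O(w^{r - s k})` on `Ω`. The norm of the `k`-th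
differential is, up to a constant depending on `k` and `n`, the maximum of the partial derivatives
`|∂^α a|` with `|α| = k`. Only the values of `a` on `Ω` matter. -/
def IsSymbolOn {n : ℕ} (Ω : Set (Phase n)) (w : Phase n → ℝ) (r s : ℝ) (a : Phase n → ℝ) : Prop :=
  ContDiffOn ℝ ∞ a Ω ∧
    ∀ k : ℕ, ∃ C : ℝ, 0 < C ∧ ∀ X ∈ Ω, ‖iteratedFDeriv ℝ k a X‖ ≤ C * w X ^ (r - s * (k : ℝ))

/-! Checks that `polarized` is the bilinear polarization of `q`, and that `hamiltonMap` is the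
unique matrix with the defining property of the Hamilton map. -/

theorem polarized_self {n : ℕ} (q : CQuadForm n) (X : Phase n) : polarized q X X = q X := by
  have h : q (X + X) = 4 * q X := by
    have := QuadraticMap.map_smul q (2 : ℝ) X
    rw [two_smul] at this
    rw [this, Complex.real_smul]
    norm_num
  rw [polarized, h]
  ring

theorem polarized_eq_sum {n : ℕ} (q : CQuadForm n) (X Y : Phase n) :
    polarized q X Y =
      ∑ k, ∑ l, (X k : ℂ) * ((Y l : ℂ) * polarized q (basisVec k) (basisVec l)) := by
  have key : ∀ A B : Phase n, polarized q A B = (2 : ℂ)⁻¹ * q.polarBilin A B := fun A B => rfl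
  have e : ∀ A : Phase n, A = ∑ k, A k • basisVec k := fun A => by
    ext j
    rcases j with j | j <;> simp [basisVec, Finset.sum_apply, Pi.single_apply]
  simp only [key]
  conv_lhs => rw [e X, e Y]
  simp only [map_sum, map_smul, LinearMap.sum_apply, LinearMap.smul_apply, Complex.real_smul,
    Finset.mul_sum]
  rw [Finset.sum_comm]
  refine Finset.sum_congr rfl fun k _ => Finset.sum_congr rfl fun l _ => ?_
  ring

theorem polarized_eq_symplecticForm {n : ℕ} (q : CQuadForm n) (X Y : Phase n) :
    polarized q X Y =
      symplecticForm (complexify X) ((hamiltonMap q).mulVec (complexify Y)) := by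
  rw [polarized_eq_sum, Fintype.sum_sum_type, symplecticForm, Finset.sum_sub_distrib, add_comm,
    sub_eq_add_neg, ← Finset.sum_neg_distrib]
  congr 1 <;> refine Finset.sum_congr rfl fun i _ => ?_ <;>
    simp only [Matrix.mulVec, dotProduct, hamiltonMap, Matrix.of_apply, complexify,
      Finset.mul_sum, ← Finset.sum_neg_distrib] <;>
    refine Finset.sum_congr rfl fun l _ => ?_ <;> ring

theorem eq_hamiltonMap {n : ℕ} (q : CQuadForm n)
    (F : Matrix (Fin n ⊕ Fin n) (Fin n ⊕ Fin n) ℂ)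
    (hF : ∀ X Y : Phase n,
      polarized q X Y = symplecticForm (complexify X) (F.mulVec (complexify Y))) :
    F = hamiltonMap q := by
  have hb : ∀ k : Fin n ⊕ Fin n, complexify (basisVec k) = Pi.single k (1 : ℂ) := fun k => by
    funext j
    by_cases h : j = k <;> simp [complexify, basisVec, h]
  ext k l
  rcases k with i | i
  · simp only [hamiltonMap, Matrix.of_apply]
    rw [hF, hb, hb]
    simp [symplecticForm, Pi.single_apply]
  · simp only [hamiltonMap, Matrix.of_apply]
    rw [hF, hb, hb]
    simp [symplecticForm, Pi.single_apply]

end QuadSys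

end

/-!
The symplectic structure enters only through the identity `H_{Im q_j} g (X) = 2 dg(X) (B_j X)` with
`B_j = Im F_j` (`hamiltonField_im`). For each `k`, the part
`T_k(X) = ∑ Re q_j (B_{l_1} ⋯ B_{l_k} X)` of the iterated sum is a nonnegative quadratic form, so
`T_k(X) = ‖U_k X‖²` for some linear map `U_k` (`exists_norm_sq_eq`), and
`‖U_{k+1} X‖² = ∑_l ‖U_k B_l X‖²` (`levelForm_succ`).

The proof avoids cutoff functions by measuring everything with the smooth scale
`ρ ^ (2p) = 1 + ∑_{j ≤ m} ‖U_j X‖ ^ (2p / (2j+1))`, where `p` is divisible by all `2j+1`, `j ≤ m`.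
Then `‖U_j X‖ ≤ ρ ^ (2j+1)`, and the hypothesis gives `⟨X⟩ ^ (1 / (2m+1)) ≲ ρ` on `Ω₀`
(`norm_le_mul_scale`). It therefore suffices to find multipliers all of whose derivatives gain
`ρ⁻¹`, with lower bound `c ρ²`. The multipliers are
`g_l = ∑_{k < m} ε_{k+1} ⟨U_k X, U_k B_l X⟩ / ρ ^ (4k+4)`.

Symbol estimates (`norm_iteratedFDeriv_multiplier_le`): by quasi-homogeneity, each term is a fixed
smooth function composed with an affine map depending on the point `X₀` under consideration; this
map sends `X₀` to a fixed compact set, and its linear part is `O(ρ(X₀)⁻¹)`.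

Lower bound (`exists_lower_bound`): with `b_k = ‖U_k X‖ / ρ ^ (2k+1) ∈ [0, 1]`, differentiating
`⟨U_k X, U_k B_l X⟩` along `B_l X` produces `‖U_k B_l X‖²`, whose sum over `l` is `‖U_{k+1} X‖²`;
the other terms contain `U_k X`, so the `k`-th term contributes at least `ρ² (b_{k+1}² - C b_k)`
(`le_fderiv_multiplier`). Since `Re q_1 + ⋯ + Re q_N = ρ² b_0²`, weights `ε_k` that decrease fast
enough, but not too fast at the end, absorb the errors up to a small multiple of the last weight
(`exists_weights`). The `b_k` cannot all be small unless `ρ` is bounded (`scale_sq_le_two`), in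
which case the constant `1` in the estimate is enough.
-/

noncomputable section

namespace QuadSys

/-! ### The adapted scale -/

/-- A common multiple of the odd numbers `1, 3, …, 2m+1`. -/
def weight (m : ℕ) : ℕ := ∏ i ∈ Finset.range (m + 1), (2 * i + 1)

/-- The exponent `weight m / (2j+1)`, which makes `‖U j X‖ ^ (2 * levelExp m j)` quasi-homogeneous
of the same degree `2 * weight m` for all `j ≤ m` when `U j X` is given degree `2j+1`. -/
def levelExp (m j : ℕ) : ℕ := weight m / (2 * j + 1)

theorem weight_pos (m : ℕ) : 0 < weight m := Finset.prod_pos fun _ _ => by positivity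

theorem levelExp_mul {m j : ℕ} (hj : j ≤ m) : (2 * j + 1) * levelExp m j = weight m :=
  Nat.mul_div_cancel' (Finset.dvd_prod_of_mem (fun i => 2 * i + 1)
    (Finset.mem_range.2 (Nat.lt_succ_of_le hj)))

theorem levelExp_pos {m j : ℕ} (hj : j ≤ m) : 0 < levelExp m j := by
  have h := levelExp_mul hj
  have := weight_pos m
  rcases Nat.eq_zero_or_pos (levelExp m j) with h0 | h0
  · rw [h0] at h; omega
  · exact h0

/-- The quasi-homogeneous sum `t + ∑_{j ≤ m} ‖y_j‖ ^ (2 * levelExp m j)`. -/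
def modelGauge {E : Type*} [NormedAddCommGroup E] (m : ℕ) (t : ℝ) (y : Fin (m + 1) → E) : ℝ :=
  t + ∑ j : Fin (m + 1), (‖y j‖ ^ 2) ^ levelExp m j

theorem one_le_modelGauge_one {E : Type*} [NormedAddCommGroup E] (m : ℕ) (y : Fin (m + 1) → E) :
    1 ≤ modelGauge m 1 y :=
  le_add_of_nonneg_right (Finset.sum_nonneg fun _ _ => by positivity)

variable {V E : Type*} [NormedAddCommGroup V] [NormedSpace ℝ V]
  [NormedAddCommGroup E] [InnerProductSpace ℝ E]

/-- The adapted scale `ρ(X)`, defined by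
`ρ(X) ^ (2 * weight m) = 1 + ∑_{j ≤ m} ‖U j X‖ ^ (2 * levelExp m j)`; up to constants it is the
maximum of `1` and the `‖U j X‖ ^ (1 / (2j+1))`. -/
def scale (m : ℕ) (U : ℕ → V →L[ℝ] E) (X : V) : ℝ :=
  modelGauge m 1 (fun j : Fin (m + 1) => U j X) ^ (1 / (2 * (weight m : ℝ)))

/-- The multiplier `⟨U k X, W X⟩ / ρ(X) ^ (4k+4)`. -/
def multiplier (m : ℕ) (U : ℕ → V →L[ℝ] E) (k : ℕ) (W : V →L[ℝ] E) (X : V) : ℝ :=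
  inner ℝ (U k X) (W X) / scale m U X ^ (4 * k + 4)

/-- The multiplier as a function of the rescaled variables: `multiplier` is the pullback of this
fixed function by affine maps, see `multiplier_eq_model`. -/
def model (m : ℕ) (k : Fin (m + 1)) (v : ℝ × (Fin (m + 1) → E) × E) : ℝ :=
  inner ℝ (v.2.1 k) v.2.2 /
    (modelGauge m v.1 v.2.1 ^ (1 / (2 * (weight m : ℝ)))) ^ (4 * (k : ℕ) + 4)

theorem scale_pow (m : ℕ) (U : ℕ → V →L[ℝ] E) (X : V) :
    scale m U X ^ (2 * weight m) = modelGauge m 1 (fun j : Fin (m + 1) => U j X) := by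
  have h := one_le_modelGauge_one m (fun j : Fin (m + 1) => U j X)
  have hw : (weight m : ℝ) ≠ 0 := by exact_mod_cast (weight_pos m).ne'
  rw [scale, ← Real.rpow_natCast, ← Real.rpow_mul (by linarith)]
  push_cast
  rw [one_div, inv_mul_cancel₀ (by positivity), Real.rpow_one]

theorem one_le_scale (m : ℕ) (U : ℕ → V →L[ℝ] E) (X : V) : 1 ≤ scale m U X :=
  Real.one_le_rpow (one_le_modelGauge_one _ _) (by positivity)

theorem norm_le_scale {m j : ℕ} (hj : j ≤ m) (U : ℕ → V →L[ℝ] E) (X : V) :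
    ‖U j X‖ ≤ scale m U X ^ (2 * j + 1) := by
  have hρ := one_le_scale m U X
  refine le_of_pow_le_pow_left₀ (n := 2 * levelExp m j) (by have := levelExp_pos hj; omega)
    (by positivity) ?_
  have e : (2 * j + 1) * (2 * levelExp m j) = 2 * weight m := by rw [← levelExp_mul hj]; ring
  rw [← pow_mul, e, scale_pow, pow_mul, modelGauge]
  have := Finset.single_le_sum (f := fun i : Fin (m + 1) => (‖U i X‖ ^ 2) ^ levelExp m i)
    (fun _ _ => by positivity) (Finset.mem_univ ⟨j, Nat.lt_succ_of_le hj⟩)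
  simp only at this
  linarith

/-- Where `|X|² ≲ ∑_{k ≤ m} ‖U k X‖²`, the adapted scale dominates `|X| ^ (1 / (2m+1))`. -/
theorem norm_le_mul_scale (m : ℕ) (U : ℕ → V →L[ℝ] E) {c₀ : ℝ}
    (hc₀ : 0 < c₀) {X : V} (hX : c₀ * ‖X‖ ^ 2 ≤ ∑ k ∈ Finset.range (m + 1), ‖U k X‖ ^ 2) :
    ‖X‖ ≤ Real.sqrt ((m + 1) / c₀) * scale m U X ^ (2 * m + 1) := by
  have hr := one_le_scale m U X
  have hsum : ∑ k ∈ Finset.range (m + 1), ‖U k X‖ ^ 2 ≤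
      (m + 1) * (scale m U X ^ (2 * m + 1)) ^ 2 := by
    refine (Finset.sum_le_sum (g := fun _ => (scale m U X ^ (2 * m + 1)) ^ 2) fun k hk => ?_).trans
      (by simp)
    have hk := Nat.lt_succ_iff.1 (Finset.mem_range.1 hk)
    gcongr
    exact (norm_le_scale hk U X).trans (pow_le_pow_right₀ hr (by omega))
  refine le_of_sq_le_sq ?_ (by positivity)
  rw [mul_pow, Real.sq_sqrt (by positivity), div_mul_eq_mul_div, le_div_iff₀ hc₀]
  linarith

/-! ### Symbol estimates for the multipliers -/

theorem contDiff_modelGauge (m : ℕ) :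
    ContDiff ℝ ∞ (fun v : ℝ × (Fin (m + 1) → E) × E => modelGauge m v.1 v.2.1) := by
  unfold modelGauge
  refine contDiff_fst.add (ContDiff.sum fun j _ => ContDiff.pow (ContDiff.norm_sq ℝ ?_) _)
  exact (contDiff_apply ℝ E j).comp (contDiff_fst.comp contDiff_snd)

theorem contDiffOn_model (m : ℕ) (k : Fin (m + 1)) :
    ContDiffOn ℝ ∞ (model (E := E) m k) {v | 0 < modelGauge m v.1 v.2.1} := by
  unfold model
  refine ContDiffOn.div ?_ ((ContDiffOn.rpow_const_of_ne (contDiff_modelGauge m).contDiffOn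
    fun v hv => ne_of_gt hv).pow _) fun v hv => ?_
  · refine ContDiff.contDiffOn (ContDiff.inner ℝ ?_ (contDiff_snd.comp contDiff_snd))
    exact (contDiff_apply ℝ E k).comp (contDiff_fst.comp contDiff_snd)
  · have : 0 < modelGauge m v.1 v.2.1 := hv
    positivity

theorem isOpen_modelGauge_pos (m : ℕ) :
    IsOpen {v : ℝ × (Fin (m + 1) → E) × E | 0 < modelGauge m v.1 v.2.1} :=
  isOpen_lt continuous_const (contDiff_modelGauge m).continuous

theorem contDiff_scale (m : ℕ) (U : ℕ → V →L[ℝ] E) : ContDiff ℝ ∞ (scale m U) := by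
  unfold scale
  refine ContDiff.rpow_const_of_ne ?_ fun X => by
    have := one_le_modelGauge_one m (fun j : Fin (m + 1) => U j X); positivity
  unfold modelGauge
  exact contDiff_const.add (ContDiff.sum fun j _ => ContDiff.pow
    (ContDiff.norm_sq ℝ (U j).contDiff) _)

theorem contDiff_multiplier (m : ℕ) (U : ℕ → V →L[ℝ] E) (k : ℕ) (W : V →L[ℝ] E) :
    ContDiff ℝ ∞ (multiplier m U k W) := by
  unfold multiplier
  refine ContDiff.div (ContDiff.inner ℝ (U k).contDiff W.contDiff)
    ((contDiff_scale m U).pow _) fun X => ?_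
  have := one_le_scale m U X
  positivity

/-- The linear part of the rescaling: `U j X` is divided by `r ^ (2j+1)` and `W X` by
`r ^ (2k+3)`. -/
def rescale (m : ℕ) (U : ℕ → V →L[ℝ] E) (k : ℕ) (W : V →L[ℝ] E) (r : ℝ) :
    V →L[ℝ] ℝ × (Fin (m + 1) → E) × E :=
  (0 : V →L[ℝ] ℝ).prod
    ((ContinuousLinearMap.pi fun j : Fin (m + 1) => (r⁻¹ ^ (2 * (j : ℕ) + 1)) • U j).prod
      ((r⁻¹ ^ (2 * k + 3)) • W))

theorem add_rescale_apply (m : ℕ) (U : ℕ → V →L[ℝ] E) (k : ℕ) (W : V →L[ℝ] E) (r t : ℝ) (X : V) :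
    (t, 0, 0) + rescale m U k W r X =
      (t, fun j : Fin (m + 1) => r⁻¹ ^ (2 * (j : ℕ) + 1) • U j X, r⁻¹ ^ (2 * k + 3) • W X) := by
  refine Prod.ext (add_zero t) (Prod.ext (funext fun j => ?_) ?_)
  · exact zero_add (r⁻¹ ^ (2 * (j : ℕ) + 1) • U j X)
  · exact zero_add (r⁻¹ ^ (2 * k + 3) • W X)

theorem modelGauge_rescale (m : ℕ) (U : ℕ → V →L[ℝ] E) (r t : ℝ) (X : V) :
    modelGauge m (r⁻¹ ^ (2 * weight m) * t)
        (fun j : Fin (m + 1) => (r⁻¹ ^ (2 * (j : ℕ) + 1)) • U j X) =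
      r⁻¹ ^ (2 * weight m) * modelGauge m t (fun j : Fin (m + 1) => U j X) := by
  simp only [modelGauge, mul_add, Finset.mul_sum]
  congr 1
  refine Finset.sum_congr rfl fun j _ => ?_
  rw [norm_smul, mul_pow, mul_pow, Real.norm_eq_abs, sq_abs, ← pow_mul, ← pow_mul]
  congr 2
  rw [← levelExp_mul (Nat.lt_succ_iff.1 j.2)]
  ring

theorem multiplier_eq_model {m : ℕ} (U : ℕ → V →L[ℝ] E) (k : Fin (m + 1)) (W : V →L[ℝ] E)
    {r : ℝ} (hr : 0 < r) :
    multiplier m U k W =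
      fun X => model m k ((r⁻¹ ^ (2 * weight m), 0, 0) + rescale m U k W r X) := by
  funext X
  have hG := one_le_modelGauge_one m (fun j : Fin (m + 1) => U j X)
  have hw : (weight m : ℝ) ≠ 0 := by exact_mod_cast (weight_pos m).ne'
  have h1 := modelGauge_rescale m U r 1 X
  rw [mul_one] at h1
  have h3 : (r⁻¹ ^ (2 * weight m)) ^ (1 / (2 * (weight m : ℝ))) = r⁻¹ := by
    rw [← Real.rpow_natCast, ← Real.rpow_mul (by positivity)]
    push_cast
    rw [mul_one_div, div_self (by positivity), Real.rpow_one]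
  rw [add_rescale_apply]
  simp only [model]
  rw [h1, Real.mul_rpow (by positivity) (by linarith), h3, multiplier, scale,
    inner_smul_left, inner_smul_right, RCLike.conj_to_real]
  have : 0 < modelGauge m 1 (fun j : Fin (m + 1) => U j X) ^ (1 / (2 * (weight m : ℝ))) := by
    positivity
  field_simp
  ring_nf

/-- The rescaled variables, at the point used for the rescaling, stay in this compact set. -/
theorem isCompact_modelGauge_eq_one [FiniteDimensional ℝ E] (m : ℕ) :
    IsCompact ({v : ℝ × (Fin (m + 1) → E) × E | modelGauge m v.1 v.2.1 = 1} ∩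
      Metric.closedBall 0 1) := by
  have : ProperSpace E := FiniteDimensional.proper_real E
  exact (isCompact_closedBall _ _).inter_left
    (isClosed_eq (contDiff_modelGauge m).continuous continuous_const)

theorem norm_rescale_le {m : ℕ} (U : ℕ → V →L[ℝ] E) (k : ℕ) (W : V →L[ℝ] E) {r : ℝ}
    (hr : 1 ≤ r) :
    ‖rescale m U k W r‖ ≤ (∑ j : Fin (m + 1), ‖U j‖ + ‖W‖) * r⁻¹ := by
  have hr0 : 0 < r⁻¹ := by positivity
  have hr1 : r⁻¹ ≤ 1 := inv_le_one_of_one_le₀ hr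
  have key : ∀ (e : ℕ) (T : V →L[ℝ] E) (X : V), e ≠ 0 →
      ‖r⁻¹ ^ e • T X‖ ≤ ‖T‖ * r⁻¹ * ‖X‖ := fun e T X he => by
    rw [norm_smul, norm_pow, Real.norm_of_nonneg hr0.le]
    have := pow_le_of_le_one hr0.le hr1 he
    calc r⁻¹ ^ e * ‖T X‖ ≤ r⁻¹ * (‖T‖ * ‖X‖) := by
          gcongr
          exact T.le_opNorm X
      _ = ‖T‖ * r⁻¹ * ‖X‖ := by ring
  have hS : 0 ≤ ∑ j : Fin (m + 1), ‖U j‖ := Finset.sum_nonneg fun _ _ => norm_nonneg _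
  refine ContinuousLinearMap.opNorm_le_bound _ (by positivity) fun X => ?_
  have hb : 0 ≤ (∑ j : Fin (m + 1), ‖U j‖ + ‖W‖) * r⁻¹ * ‖X‖ := by positivity
  refine norm_prod_le_iff.2 ⟨by simpa [rescale] using hb, norm_prod_le_iff.2 ⟨?_, ?_⟩⟩
  · refine (pi_norm_le_iff_of_nonneg hb).2 fun j => (key _ (U j) X (by omega)).trans ?_
    have := Finset.single_le_sum (f := fun j : Fin (m + 1) => ‖U j‖)
      (fun _ _ => norm_nonneg _) (Finset.mem_univ j)
    gcongr
    linarith [norm_nonneg W]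
  · refine (key _ W X (by omega)).trans ?_
    gcongr
    linarith

/-- Each derivative of the multiplier gains a factor `ρ(X)⁻¹`: the multiplier is the pullback of a
fixed smooth function by an affine map whose linear part is `O(ρ(X)⁻¹)` and which sends `X` to a
fixed compact set. -/
theorem norm_iteratedFDeriv_multiplier_le [FiniteDimensional ℝ E] {m k : ℕ} (hk : k < m)
    (U : ℕ → V →L[ℝ] E) (W : V →L[ℝ] E) (hW : ∀ X, ‖W X‖ ≤ ‖U (k + 1) X‖) (i : ℕ) :
    ∃ C : ℝ, 0 < C ∧ ∀ X, ‖iteratedFDeriv ℝ i (multiplier m U k W) X‖ ≤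
      C * (scale m U X)⁻¹ ^ i := by
  lift k to Fin (m + 1) using by omega with k
  set O := {v : ℝ × (Fin (m + 1) → E) × E | 0 < modelGauge m v.1 v.2.1} with hO
  have hOo : IsOpen O := isOpen_modelGauge_pos m
  have hcont : ContinuousOn (iteratedFDeriv ℝ i (model (E := E) m k)) O :=
    ((contDiffOn_model m k).continuousOn_iteratedFDerivWithin (m := i)
      (by exact_mod_cast le_top) hOo.uniqueDiffOn).congr fun v hv =>
        (iteratedFDerivWithin_of_isOpen i hOo hv).symm
  obtain ⟨C, hC⟩ := (isCompact_modelGauge_eq_one (E := E) m).exists_bound_of_continuousOn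
    (hcont.mono fun v hv => by
      have h1 : modelGauge m v.1 v.2.1 = 1 := hv.1
      simp only [hO, Set.mem_ofPred_eq, h1, one_pos])
  set M := ∑ j : Fin (m + 1), ‖U j‖ + ‖W‖ with hM
  have hM0 : 0 ≤ M := add_nonneg (Finset.sum_nonneg fun _ _ => norm_nonneg _) (norm_nonneg _)
  refine ⟨|C| * M ^ i + 1, by positivity, fun X => ?_⟩
  have hr := one_le_scale m U X
  set r := scale m U X with hrdef
  have hr0 : 0 < r := by linarith
  set a : ℝ × (Fin (m + 1) → E) × E := (r⁻¹ ^ (2 * weight m), 0, 0) with ha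
  set L := rescale m U k W r with hL
  -- the affine image of `X` lies in the compact set
  have hmem : a + L X ∈ ({v : ℝ × (Fin (m + 1) → E) × E | modelGauge m v.1 v.2.1 = 1} ∩
      Metric.closedBall 0 1) := by
    constructor
    · have h1 := modelGauge_rescale m U r 1 X
      rw [mul_one, ← scale_pow, ← hrdef, ← mul_pow, inv_mul_cancel₀ hr0.ne', one_pow] at h1
      rw [ha, hL, add_rescale_apply]
      exact h1
    · have key : ∀ (e : ℕ) (y : E), ‖y‖ ≤ r ^ e → ‖r⁻¹ ^ e • y‖ ≤ 1 := fun e y hy => by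
        rw [norm_smul, norm_pow, Real.norm_of_nonneg (by positivity), inv_pow,
          inv_mul_le_iff₀ (by positivity), mul_one]
        exact hy
      rw [mem_closedBall_zero_iff, ha, hL, add_rescale_apply]
      refine norm_prod_le_iff.2 ⟨?_, norm_prod_le_iff.2 ⟨?_, ?_⟩⟩
      · rw [Real.norm_of_nonneg (by positivity)]
        exact pow_le_one₀ (by positivity) (inv_le_one_of_one_le₀ hr)
      · exact (pi_norm_le_iff_of_nonneg zero_le_one).2 fun j =>
          key _ _ (norm_le_scale (Nat.lt_succ_iff.1 j.2) U X)
      · exact key _ _ ((hW X).trans (norm_le_scale (j := (k : ℕ) + 1) (by omega) U X))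
  have hmemO : a + L X ∈ O := by
    have h1 : modelGauge m (a + L X).1 (a + L X).2.1 = 1 := hmem.1
    simp only [hO, Set.mem_ofPred_eq, h1, one_pos]
  -- chain rule for the affine map `Y ↦ a + L Y`
  have hchain : iteratedFDeriv ℝ i (multiplier m U k W) X =
      (iteratedFDeriv ℝ i (model m k) (a + L X)).compContinuousLinearMap fun _ => L := by
    set O' := (fun v => a + v) ⁻¹' O with hO'
    have hO'o : IsOpen O' := hOo.preimage (by fun_prop)
    have hsm : ContDiffOn ℝ ∞ (fun v => model m k (a + v)) O' :=
      (contDiffOn_model m k).comp (contDiff_const.add contDiff_id).contDiffOn fun v hv => hv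
    have hpre : IsOpen (L ⁻¹' O') := hO'o.preimage L.continuous
    have := L.iteratedFDerivWithin_comp_right hsm hO'o.uniqueDiffOn hpre.uniqueDiffOn
      (x := X) hmemO (i := i) (by exact_mod_cast le_top)
    rw [iteratedFDerivWithin_of_isOpen i hpre hmemO,
      iteratedFDerivWithin_of_isOpen i hO'o hmemO, iteratedFDeriv_comp_add_left] at this
    rw [← this, multiplier_eq_model U k W hr0]
    rfl
  rw [hchain]
  refine (ContinuousMultilinearMap.norm_compContinuousLinearMap_le _ _).trans ?_
  rw [Finset.prod_const, Finset.card_univ, Fintype.card_fin]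
  calc ‖iteratedFDeriv ℝ i (model m k) (a + L X)‖ * ‖L‖ ^ i
      ≤ |C| * (M * r⁻¹) ^ i := by
        gcongr
        · exact (hC _ hmem).trans (le_abs_self C)
        · exact norm_rescale_le U k W hr
    _ = |C| * M ^ i * r⁻¹ ^ i := by rw [mul_pow]; ring
    _ ≤ (|C| * M ^ i + 1) * r⁻¹ ^ i := by
        gcongr
        linarith

/-! ### Derivatives of the multipliers along the vector fields -/

theorem hasFDerivAt_modelGauge (m : ℕ) (U : ℕ → V →L[ℝ] E) (X : V) :
    HasFDerivAt (fun X => modelGauge m 1 (fun j : Fin (m + 1) => U j X))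
      (∑ j : Fin (m + 1), (levelExp m j * (‖U j X‖ ^ 2) ^ (levelExp m j - 1)) •
        (2 • (innerSL ℝ (U j X)).comp (U j))) X := by
  unfold modelGauge
  refine HasFDerivAt.const_add _ (HasFDerivAt.fun_sum fun j _ => ?_)
  simpa using ((U j).hasFDerivAt (x := X)).norm_sq.pow (levelExp m j)

/-- A vector `Y` which, like `B l X`, has components `U j Y` of degree at most `2j+3` changes the
scale `ρ` at a rate of at most `ρ³`. -/
theorem abs_fderiv_scale_le {m : ℕ} (U : ℕ → V →L[ℝ] E) {C : ℝ} (hC : 0 ≤ C) {X Y : V}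
    (hY : ∀ j ≤ m, ‖U j Y‖ ≤ C * scale m U X ^ (2 * j + 3)) :
    |fderiv ℝ (scale m U) X Y| ≤ (m + 1) * C * scale m U X ^ 3 := by
  have hr := one_le_scale m U X
  have hw := weight_pos m
  set r := scale m U X with hrdef
  have hr0 : 0 < r := by linarith
  have hd : HasFDerivAt (scale m U) (fderiv ℝ (scale m U) X) X :=
    ((contDiff_scale m U).differentiable (by simp)).differentiableAt.hasFDerivAt
  have h1 := hd.pow (2 * weight m)
  have h2 : (fun X => scale m U X ^ (2 * weight m)) =
      fun X => modelGauge m 1 (fun j : Fin (m + 1) => U j X) := funext (scale_pow m U)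
  have h3 := DFunLike.congr_fun (h1.unique (h2 ▸ hasFDerivAt_modelGauge m U X)) Y
  simp only [smul_apply, sum_apply, smul_eq_mul, nsmul_eq_mul,
    ContinuousLinearMap.comp_apply, innerSL_apply_apply] at h3
  rw [← hrdef] at h3
  have hterm : ∀ j : Fin (m + 1), |(levelExp m j * (‖U j X‖ ^ 2) ^ (levelExp m j - 1)) *
      (((2 : ℕ) : ℝ) * inner ℝ (U j X) (U j Y))| ≤ 2 * weight m * C * r ^ (2 * weight m + 2) := by
    intro j
    have hj := Nat.lt_succ_iff.1 j.2
    have hp := levelExp_pos hj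
    have he := levelExp_mul hj
    have hle : levelExp m j ≤ weight m := Nat.div_le_self _ _
    have hexp : (2 * (j : ℕ) + 1) * (2 * (levelExp m j - 1)) + (2 * j + 1) + (2 * j + 3) =
        2 * weight m + 2 := by
      obtain ⟨e, he'⟩ := Nat.exists_eq_succ_of_ne_zero hp.ne'
      rw [← he, he', Nat.succ_sub_one, Nat.succ_eq_add_one]
      ring
    have hU := norm_le_scale hj U X
    rw [← hrdef] at hU
    have hin := abs_real_inner_le_norm (U j X) (U j Y)
    rw [abs_mul, abs_mul ((2 : ℕ) : ℝ), abs_of_nonneg (by positivity : (0 : ℝ) ≤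
      levelExp m j * (‖U j X‖ ^ 2) ^ (levelExp m j - 1)), ← pow_mul, ← hexp, pow_add, pow_add,
      pow_mul r]
    calc levelExp m j * ‖U j X‖ ^ (2 * (levelExp m j - 1)) * (|((2 : ℕ) : ℝ)| *
          |inner ℝ (U j X) (U j Y)|)
        ≤ weight m * (r ^ (2 * (j : ℕ) + 1)) ^ (2 * (levelExp m j - 1)) * (2 *
          (r ^ (2 * (j : ℕ) + 1) * (C * r ^ (2 * (j : ℕ) + 3)))) := by
          gcongr
          · simp
          · exact hin.trans (by gcongr; exact hY j hj)
      _ = _ := by ring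
  have hsum := (Finset.abs_sum_le_sum_abs _ _).trans
    (Finset.sum_le_sum fun (j : Fin (m + 1)) (_ : j ∈ Finset.univ) => hterm j)
  rw [← h3, Finset.sum_const, Finset.card_univ, Fintype.card_fin, nsmul_eq_mul, abs_mul] at hsum
  have hw' : (0 : ℝ) < weight m := by exact_mod_cast hw
  rw [abs_of_pos (by positivity)] at hsum
  have hpow : r ^ (2 * weight m + 2) = r ^ (2 * weight m - 1) * r ^ 3 := by
    rw [← pow_add]; congr 1; omega
  have hq : 0 < 2 * (weight m : ℝ) * r ^ (2 * weight m - 1) := by positivity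
  refine le_of_mul_le_mul_left ?_ hq
  rw [hpow] at hsum
  push_cast at hsum
  refine hsum.trans (le_of_eq ?_)
  ring

theorem fderiv_multiplier_apply (m : ℕ) (U : ℕ → V →L[ℝ] E) (k : ℕ) (W : V →L[ℝ] E) (X Y : V) :
    fderiv ℝ (multiplier m U k W) X Y =
      (inner ℝ (U k Y) (W X) + inner ℝ (U k X) (W Y)) / scale m U X ^ (4 * k + 4) -
        (4 * k + 4) * inner ℝ (U k X) (W X) * fderiv ℝ (scale m U) X Y /
          scale m U X ^ (4 * k + 5) := by
  have hr := one_le_scale m U X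
  have hr0 : scale m U X ≠ 0 := by positivity
  have hd : HasFDerivAt (scale m U) (fderiv ℝ (scale m U) X) X :=
    ((contDiff_scale m U).differentiable (by simp)).differentiableAt.hasFDerivAt
  have hinv : HasFDerivAt (fun Z => (scale m U Z ^ (4 * k + 4))⁻¹) _ X :=
    (hasDerivAt_inv (pow_ne_zero (4 * k + 4) hr0)).comp_hasFDerivAt X (hd.pow (4 * k + 4))
  have hin : HasFDerivAt (fun Z => inner ℝ (U k Z) (W Z)) _ X :=
    ((U k).hasFDerivAt (x := X)).inner ℝ (W.hasFDerivAt (x := X))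
  have h : HasFDerivAt (multiplier m U k W) _ X := hin.mul hinv
  rw [h.fderiv]
  simp only [add_apply, smul_apply, smul_eq_mul, nsmul_eq_mul,
    ContinuousLinearMap.comp_apply, ContinuousLinearMap.prod_apply, fderivInnerCLM_apply]
  rw [show 4 * k + 4 - 1 = 4 * k + 3 from rfl]
  push_cast
  field_simp
  ring

/-- Along `B`, the multiplier `⟨U k X, U k (B X)⟩ / ρ ^ (4k+4)` grows like
`‖U k (B X)‖² / ρ ^ (4k+4)`, up to terms that are small where `U k X` is. -/
theorem le_fderiv_multiplier {m k : ℕ} (hk : k < m) (U : ℕ → V →L[ℝ] E) (B : V →L[ℝ] V)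
    (hU : ∀ j X, ‖U j (B X)‖ ≤ ‖U (j + 1) X‖) {C : ℝ} (hC : 0 ≤ C) {X : V}
    (hX : ∀ j ≤ m, ‖U j (B X)‖ ≤ C * scale m U X ^ (2 * j + 3)) :
    ‖U k (B X)‖ ^ 2 / scale m U X ^ (4 * k + 4) -
        (C + (4 * m + 4) * (m + 1) * C ^ 2) * scale m U X ^ 2 *
          (‖U k X‖ / scale m U X ^ (2 * k + 1)) ≤
      fderiv ℝ (multiplier m U k ((U k).comp B)) X (B X) := by
  have hD := abs_fderiv_scale_le U hC hX
  have hr := one_le_scale m U X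
  rw [fderiv_multiplier_apply]
  set r := scale m U X with hrdef
  set D := fderiv ℝ (scale m U) X (B X)
  have hr0 : 0 < r := by linarith
  simp only [ContinuousLinearMap.comp_apply, real_inner_self_eq_norm_sq]
  have h1 : |inner ℝ (U k X) (U k (B (B X)))| ≤ ‖U k X‖ * (C * r ^ (2 * k + 5)) :=
    (abs_real_inner_le_norm _ _).trans (by
      gcongr
      exact (hU k (B X)).trans (hX (k + 1) hk))
  have h2 : |inner ℝ (U k X) (U k (B X))| ≤ ‖U k X‖ * (C * r ^ (2 * k + 3)) :=
    (abs_real_inner_le_norm _ _).trans (by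
      gcongr
      exact hX k hk.le)
  have h3 : |(4 * (k : ℝ) + 4) * inner ℝ (U k X) (U k (B X)) * D| ≤
      (4 * m + 4) * (‖U k X‖ * (C * r ^ (2 * k + 3))) * ((m + 1) * C * r ^ 3) := by
    rw [abs_mul, abs_mul, abs_of_nonneg (by positivity : (0 : ℝ) ≤ 4 * (k : ℝ) + 4)]
    gcongr
  have e1 : ‖U k X‖ * (C * r ^ (2 * k + 5)) / r ^ (4 * k + 4) =
      C * r ^ 2 * (‖U k X‖ / r ^ (2 * k + 1)) := by
    field_simp
    ring
  have e2 : (4 * m + 4) * (‖U k X‖ * (C * r ^ (2 * k + 3))) * ((m + 1) * C * r ^ 3) /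
      r ^ (4 * k + 5) =
      (4 * m + 4) * (m + 1) * C ^ 2 * r ^ 2 * (‖U k X‖ / r ^ (2 * k + 1)) := by
    field_simp
    ring
  have i1 := div_le_div_of_nonneg_right (neg_le_of_abs_le h1) (by positivity :
    0 ≤ r ^ (4 * k + 4))
  have i2 := div_le_div_of_nonneg_right (le_of_abs_le h3) (by positivity :
    0 ≤ r ^ (4 * k + 5))
  rw [neg_div, e1] at i1
  rw [e2] at i2
  rw [add_div]
  linarith

/-! ### The lower bound -/

/-- Weights `δ ^ (3^m - 3^(m-k))`, for small `δ`, absorb each error `C b_k` at level `k+1` into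
the square `b_k ^ 2` at level `k` and the smallest of the weights. -/
theorem exists_weights (m : ℕ) {C : ℝ} (hC : 0 ≤ C) :
    ∃ (ε : ℕ → ℝ) (c : ℝ), 0 < c ∧ c ≤ 1 / 8 ∧ (∀ k, 0 < ε k) ∧ ∀ b : ℕ → ℝ,
      c * (4 * ∑ k ∈ Finset.range (m + 1), b k ^ 2 - 1) ≤
        b 0 ^ 2 + ∑ k ∈ Finset.range m, ε (k + 1) * (b (k + 1) ^ 2 - C * b k) := by
  set δ : ℝ := 1 / (1 + 4 * (m * C ^ 2)) with hδ
  have hmC : 0 ≤ m * C ^ 2 := by positivity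
  have hδ0 : 0 < δ := by positivity
  have hδ1 : δ ≤ 1 := by rw [hδ, div_le_one (by positivity)]; linarith
  have hδC : δ * (4 * (m * C ^ 2)) ≤ 1 := by
    rw [hδ, one_div, inv_mul_le_iff₀ (by positivity)]; linarith
  set e : ℕ → ℕ := fun k => 3 ^ m - 3 ^ (m - k) with he
  have hem : e m = 3 ^ m - 1 := by simp [he]
  refine ⟨fun k => δ ^ e k, δ ^ e m / 8, by positivity, ?_, fun k => by positivity, fun b => ?_⟩
  · have := pow_le_one₀ hδ0.le hδ1 (n := e m)
    linarith
  have hmono : ∀ k, δ ^ e m ≤ δ ^ e k := fun k => by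
    refine pow_le_pow_of_le_one hδ0.le hδ1 ?_
    rw [hem]
    exact Nat.sub_le_sub_left (Nat.one_le_pow _ _ (by norm_num)) _
  have hstep : ∀ k ∈ Finset.range m,
      δ ^ e k * b k ^ 2 / 2 - δ ^ e m * (δ * C ^ 2 / 2) ≤
        δ ^ e k * b k ^ 2 - δ ^ e (k + 1) * (C * b k) := by
    intro k hk
    have hkm := Finset.mem_range.1 hk
    -- `2 e_{k+1} ≥ e_k + e_m + 1`
    obtain ⟨f, hf⟩ : ∃ f, 2 * e (k + 1) = e k + (e m + 1 + f) := by
      refine ⟨2 * e (k + 1) - (e k + (e m + 1)), ?_⟩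
      have h1 : 3 ^ (m - k) = 3 * 3 ^ (m - (k + 1)) := by
        rw [← pow_succ']; congr 1; omega
      have h2 : 3 ^ (m - k) ≤ 3 ^ m := Nat.pow_le_pow_right (by norm_num) (by omega)
      have h3 : 1 ≤ 3 ^ (m - (k + 1)) := Nat.one_le_pow _ _ (by norm_num)
      have h4 : e m + 1 = 3 ^ m := by rw [hem]; omega
      rw [h4]
      simp only [he]
      omega
    have hsq : (δ ^ e (k + 1)) ^ 2 = δ ^ e k * (δ ^ e m * δ * δ ^ f) := by
      rw [← pow_mul, mul_comm, hf]
      ring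
    have hf1 : δ ^ f ≤ 1 := pow_le_one₀ hδ0.le hδ1
    have hle : (δ ^ e (k + 1)) ^ 2 ≤ δ ^ e k * (δ ^ e m * δ) := by
      rw [hsq]
      refine mul_le_mul_of_nonneg_left ?_ (by positivity)
      exact mul_le_of_le_one_right (by positivity) hf1
    have hA : 0 < δ ^ e k := by positivity
    generalize δ ^ e k = A at *
    generalize δ ^ e (k + 1) = A' at *
    generalize δ ^ e m = M at *
    refine le_of_mul_le_mul_left ?_ hA
    have h1 := sq_nonneg (A * b k - C * A')
    have h2 := mul_le_mul_of_nonneg_right hle (sq_nonneg C)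
    nlinarith
  have hsum := Finset.sum_le_sum hstep
  rw [Finset.sum_sub_distrib, Finset.sum_const, Finset.card_range, nsmul_eq_mul] at hsum
  -- shift the index in the squares `b (k + 1) ^ 2`, which moves them to level `k`
  have htel : b 0 ^ 2 + ∑ k ∈ Finset.range m, δ ^ e (k + 1) * (b (k + 1) ^ 2 - C * b k) =
      ∑ k ∈ Finset.range m, (δ ^ e k * b k ^ 2 - δ ^ e (k + 1) * (C * b k)) +
        δ ^ e m * b m ^ 2 := by
    have h1 := Finset.sum_range_succ (fun k => δ ^ e k * b k ^ 2) m
    have h2 := Finset.sum_range_succ' (fun k => δ ^ e k * b k ^ 2) m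
    have h0 : e 0 = 0 := by simp [he]
    simp only [h0, pow_zero, one_mul] at h2
    simp only [mul_sub, Finset.sum_sub_distrib]
    linarith
  rw [htel, Finset.sum_range_succ]
  have hlow : ∑ k ∈ Finset.range m, δ ^ e m * b k ^ 2 / 2 ≤
      ∑ k ∈ Finset.range m, δ ^ e k * b k ^ 2 / 2 :=
    Finset.sum_le_sum fun k _ => by
      have := hmono k
      gcongr
  have hfac : ∑ k ∈ Finset.range m, δ ^ e m * b k ^ 2 / 2 =
      δ ^ e m / 2 * ∑ k ∈ Finset.range m, b k ^ 2 := by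
    rw [Finset.mul_sum]
    exact Finset.sum_congr rfl fun k _ => by ring
  have hM : 0 < δ ^ e m := by positivity
  have hm2 : 0 ≤ δ ^ e m * b m ^ 2 := by positivity
  have herr : (m : ℝ) * (δ ^ e m * (δ * C ^ 2 / 2)) ≤ δ ^ e m / 8 := by
    have := mul_le_mul_of_nonneg_left hδC hM.le
    nlinarith
  nlinarith

/-- Where all the `‖U k X‖ / ρ ^ (2k+1)`, `k ≤ m`, are small, the scale is bounded. -/
theorem scale_sq_le_two {m : ℕ} (U : ℕ → V →L[ℝ] E) {X : V}
    (h : ∑ k ∈ Finset.range (m + 1), (‖U k X‖ / scale m U X ^ (2 * k + 1)) ^ 2 < 1 / 2) :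
    scale m U X ^ 2 ≤ 2 := by
  have hr := one_le_scale m U X
  have hpow := scale_pow m U X
  have hns : ∀ j ≤ m, ‖U j X‖ ≤ scale m U X ^ (2 * j + 1) := fun j hj => norm_le_scale hj U X
  set r := scale m U X with hrdef
  have hr0 : 0 < r := by linarith
  have hle : ∑ j : Fin (m + 1), (‖U j X‖ ^ 2) ^ levelExp m j ≤
      r ^ (2 * weight m) * ∑ k ∈ Finset.range (m + 1), (‖U k X‖ / r ^ (2 * k + 1)) ^ 2 := by
    rw [Finset.sum_range, Finset.mul_sum]
    refine Finset.sum_le_sum fun j _ => ?_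
    have hj := Nat.lt_succ_iff.1 j.2
    have hb1 : ‖U j X‖ / r ^ (2 * (j : ℕ) + 1) ≤ 1 := (div_le_one (by positivity)).2 (hns j hj)
    have e1 : ‖U j X‖ = r ^ (2 * (j : ℕ) + 1) * (‖U j X‖ / r ^ (2 * (j : ℕ) + 1)) := by
      field_simp
    have hb0 : 0 ≤ ‖U j X‖ / r ^ (2 * (j : ℕ) + 1) := by positivity
    generalize ‖U j X‖ / r ^ (2 * (j : ℕ) + 1) = b at *
    have hp := levelExp_pos hj
    rw [e1, ← pow_mul, mul_pow, ← pow_mul, ← levelExp_mul hj,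
      (by ring : (2 * (j : ℕ) + 1) * (2 * levelExp m j) = 2 * ((2 * j + 1) * levelExp m j))]
    exact mul_le_mul_of_nonneg_left (pow_le_pow_of_le_one hb0 hb1 (by omega)) (by positivity)
  rw [modelGauge] at hpow
  have hw := weight_pos m
  have h2 : r ^ 2 ≤ r ^ (2 * weight m) := pow_le_pow_right₀ hr (by omega)
  have hr2 : 0 < r ^ (2 * weight m) := by positivity
  nlinarith

/-- The lower bound in terms of the adapted scale: a suitable combination of the multipliers
compensates the degeneracy of `‖U 0 X‖ ^ 2`. -/
theorem exists_lower_bound {N : ℕ} (m : ℕ) (U : ℕ → V →L[ℝ] E) (B : Fin N → V →L[ℝ] V)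
    (hU : ∀ k X, ‖U (k + 1) X‖ ^ 2 = ∑ l, ‖U k (B l X)‖ ^ 2) {K : ℝ} (hK : 0 ≤ K) :
    ∃ (ε : ℕ → ℝ) (c : ℝ), 0 < c ∧ (∀ k, 0 < ε k) ∧
      ∀ X, ‖X‖ ≤ K * scale m U X ^ (2 * m + 1) →
        c * scale m U X ^ 2 ≤ 1 + (‖U 0 X‖ ^ 2 + ∑ l, ∑ k ∈ Finset.range m,
          ε (k + 1) * fderiv ℝ (multiplier m U k ((U k).comp (B l))) X (B l X)) := by
  have hUB : ∀ l j X, ‖U j (B l X)‖ ≤ ‖U (j + 1) X‖ := fun l j X => by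
    refine le_of_sq_le_sq ?_ (norm_nonneg _)
    rw [hU]
    exact Finset.single_le_sum (f := fun l => ‖U j (B l X)‖ ^ 2) (fun _ _ => by positivity)
      (Finset.mem_univ l)
  set C : ℝ := 1 + ‖U m‖ * (∑ l, ‖B l‖) * K with hCdef
  have hS : 0 ≤ ∑ l, ‖B l‖ := Finset.sum_nonneg fun _ _ => norm_nonneg _
  have hC : 0 ≤ C := by positivity
  set C' : ℝ := C + (4 * m + 4) * (m + 1) * C ^ 2 with hC'def
  obtain ⟨ε, c, hc, hc8, hε, hb⟩ := exists_weights m (C := N * C') (by positivity)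
  refine ⟨ε, c, hc, hε, fun X hX => ?_⟩
  have hr := one_le_scale m U X
  have hsmall := scale_sq_le_two (m := m) U (X := X)
  have hns : ∀ j ≤ m, ‖U j X‖ ≤ scale m U X ^ (2 * j + 1) := fun j hj => norm_le_scale hj U X
  have hbd : ∀ l, ∀ j ≤ m, ‖U j (B l X)‖ ≤ C * scale m U X ^ (2 * j + 3) := by
    intro l j hj
    rcases hj.lt_or_eq with hlt | rfl
    · refine (hUB l j X).trans ((hns (j + 1) hlt).trans ?_)
      refine le_mul_of_one_le_left (by positivity) ?_
      rw [hCdef]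
      exact le_add_of_nonneg_right (by positivity)
    · have hBl : ‖B l‖ ≤ ∑ l, ‖B l‖ :=
        Finset.single_le_sum (f := fun l => ‖B l‖) (fun _ _ => norm_nonneg _) (Finset.mem_univ l)
      calc ‖U j (B l X)‖ ≤ ‖U j‖ * (‖B l‖ * ‖X‖) :=
            ((U j).le_opNorm _).trans (by gcongr; exact (B l).le_opNorm X)
        _ ≤ ‖U j‖ * ((∑ l, ‖B l‖) * (K * scale j U X ^ (2 * j + 1))) := by gcongr
        _ = (‖U j‖ * (∑ l, ‖B l‖) * K) * scale j U X ^ (2 * j + 1) := by ring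
        _ ≤ C * scale j U X ^ (2 * j + 3) := by
            rw [hCdef]
            gcongr ?_ * ?_
            · linarith
            · exact pow_le_pow_right₀ hr (by omega)
  have hder : ∀ l, ∀ k ∈ Finset.range m, _ := fun l k hk =>
    le_fderiv_multiplier (Finset.mem_range.1 hk) U (B l) (hUB l) hC (hbd l)
  set r := scale m U X with hrdef
  have hr0 : 0 < r := by linarith
  set b : ℕ → ℝ := fun k => ‖U k X‖ / r ^ (2 * k + 1) with hbdef
  have hlevel : ∀ k ∈ Finset.range m, r ^ 2 * (b (k + 1) ^ 2 - N * C' * b k) ≤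
      ∑ l, fderiv ℝ (multiplier m U k ((U k).comp (B l))) X (B l X) := by
    intro k hk
    refine le_trans (le_of_eq ?_) (Finset.sum_le_sum fun l _ => hder l k hk)
    rw [Finset.sum_sub_distrib, ← Finset.sum_div, ← hU, Finset.sum_const, Finset.card_univ,
      Fintype.card_fin, nsmul_eq_mul]
    simp only [hbdef]
    field_simp
    ring
  have h0 : ‖U 0 X‖ ^ 2 = r ^ 2 * b 0 ^ 2 := by
    simp only [hbdef]
    field_simp
    ring
  have hmain : r ^ 2 * (c * (4 * ∑ k ∈ Finset.range (m + 1), b k ^ 2 - 1)) ≤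
      ‖U 0 X‖ ^ 2 + ∑ l, ∑ k ∈ Finset.range m,
          ε (k + 1) * fderiv ℝ (multiplier m U k ((U k).comp (B l))) X (B l X) := by
    rw [Finset.sum_comm]
    simp only [← Finset.mul_sum]
    refine (mul_le_mul_of_nonneg_left (hb b) (by positivity)).trans ?_
    rw [mul_add, ← h0, Finset.mul_sum]
    refine add_le_add le_rfl (Finset.sum_le_sum fun k hk => ?_)
    rw [mul_left_comm]
    exact mul_le_mul_of_nonneg_left (hlevel k hk) (hε _).le
  have hr2 : 0 < r ^ 2 := by positivity
  set S := ∑ k ∈ Finset.range (m + 1), b k ^ 2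
  have hS0 : 0 ≤ S := Finset.sum_nonneg fun _ _ => sq_nonneg _
  rcases lt_or_ge S (1 / 2) with hlt | hge
  · have h2 := hsmall hlt
    have h3 : c * r ^ 2 ≤ 1 / 8 * 2 := by gcongr
    have h4 : 0 ≤ r ^ 2 * (c * (4 * S)) := by positivity
    linarith
  · have h4 : 0 ≤ r ^ 2 * c * (4 * S - 2) := mul_nonneg (by positivity) (by linarith)
    linarith

/-! ### Quadratic forms and Hamilton maps -/

/-- A nonnegative quadratic form is the square of the norm of a linear map. -/
theorem exists_norm_sq_eq {V : Type*} [NormedAddCommGroup V] [NormedSpace ℝ V]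
    [FiniteDimensional ℝ V] (T : QuadraticForm ℝ V) (hT : ∀ X, 0 ≤ T X) :
    ∃ U : V →L[ℝ] EuclideanSpace ℝ (Fin (Module.finrank ℝ V)), ∀ X, ‖U X‖ ^ 2 = T X := by
  obtain ⟨w, ⟨e⟩⟩ := QuadraticForm.equivalent_weightedSumSquares T
  have hw : ∀ i, 0 ≤ w i := fun i => by
    have h := hT (e.symm (Pi.single i 1))
    have h2 := e.map_app (e.symm (Pi.single i 1))
    rw [← h2] at h
    have h3 : e (e.symm (Pi.single i 1)) = Pi.single i (1 : ℝ) := e.toLinearEquiv.apply_symm_apply _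
    change 0 ≤ QuadraticMap.weightedSumSquares ℝ w (e (e.symm (Pi.single i 1))) at h
    rw [h3] at h
    simpa [QuadraticMap.weightedSumSquares_apply, Pi.single_apply] using h
  refine ⟨LinearMap.toContinuousLinearMap
    ((WithLp.linearEquiv 2 ℝ (Fin (Module.finrank ℝ V) → ℝ)).symm.toLinearMap ∘ₗ
      (LinearMap.pi fun i => Real.sqrt (w i) • LinearMap.proj i) ∘ₗ
        e.toLinearEquiv.toLinearMap), fun X => ?_⟩
  rw [EuclideanSpace.norm_sq_eq, ← e.map_app X, QuadraticMap.weightedSumSquares_apply]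
  refine Finset.sum_congr rfl fun i _ => ?_
  change ‖Real.sqrt (w i) * e X i‖ ^ 2 = _
  rw [norm_mul, mul_pow, Real.norm_eq_abs, sq_abs, Real.sq_sqrt (hw i), Real.norm_eq_abs, sq_abs,
    smul_eq_mul, sq]

variable {n N : ℕ}

/-- The part of `iteratedSum` with `k` factors `Im F`, as a real quadratic form. -/
def levelForm (q : Fin N → CQuadForm n) (k : ℕ) : QuadraticForm ℝ (Phase n) :=
  ∑ l : Fin k → Fin N, ∑ j : Fin N,
    (Complex.reLm.compQuadraticMap (q j)).comp (imHamiltonProd q l)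

theorem levelForm_apply (q : Fin N → CQuadForm n) (k : ℕ) (X : Phase n) :
    levelForm q k X = ∑ l : Fin k → Fin N, ∑ j : Fin N, (q j (imHamiltonProd q l X)).re := by
  simp [levelForm]

theorem iteratedSum_eq (q : Fin N → CQuadForm n) (m : ℕ) (X : Phase n) :
    iteratedSum q m X = ∑ k ∈ Finset.range (m + 1), levelForm q k X := by
  simp only [iteratedSum, levelForm_apply]
  exact Finset.sum_congr rfl fun k _ => Finset.sum_comm

theorem levelForm_zero (q : Fin N → CQuadForm n) (X : Phase n) :
    levelForm q 0 X = ∑ j, (q j X).re := by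
  simp [levelForm_apply, imHamiltonProd]

theorem imHamiltonProd_snoc (q : Fin N → CQuadForm n) {k : ℕ} (l : Fin k → Fin N) (i : Fin N)
    (X : Phase n) :
    imHamiltonProd q (Fin.snoc l i : Fin (k + 1) → Fin N) X =
      imHamiltonProd q l (imHamiltonMap (q i) X) := by
  rw [imHamiltonProd, List.ofFn_succ_last]
  simp [imHamiltonProd, -List.ofFn_succ]

theorem levelForm_succ (q : Fin N → CQuadForm n) (k : ℕ) (X : Phase n) :
    levelForm q (k + 1) X = ∑ i, levelForm q k (imHamiltonMap (q i) X) := by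
  simp only [levelForm_apply]
  rw [← (Fin.snocEquiv fun _ => Fin N).sum_comp, Fintype.sum_prod_type]
  refine Finset.sum_congr rfl fun i _ => Finset.sum_congr rfl fun l _ =>
    Finset.sum_congr rfl fun j _ => ?_
  rw [← imHamiltonProd_snoc]
  rfl

theorem fderiv_im_apply (q : CQuadForm n) (X Y : Phase n) :
    fderiv ℝ (fun Z => (q Z).im) X Y = 2 * (polarized q Y X).im := by
  have hline : HasLineDerivAt ℝ (fun Z => (q Z).im) (2 * (polarized q Y X).im) X Y := by
    have e : ∀ t : ℝ, (q (X + t • Y)).im =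
        (q X).im + t * (2 * (polarized q Y X).im) + t ^ 2 * (q Y).im := fun t => by
      have h1 : q (X + t • Y) = q X + t • (2 * polarized q Y X) + (t * t) • q Y := by
        have h2 := QuadraticMap.polar_smul_right q t X Y
        simp only [QuadraticMap.polar, QuadraticMap.map_smul] at h2
        rw [polarized, add_comm Y X]
        have : q (X + t • Y) = t • (q (X + Y) - q X - q Y) + q X + (t * t) • q Y := by
          rw [← h2]; ring
        rw [this]
        simp only [Complex.real_smul]
        ring
      rw [h1]
      simp only [Complex.add_im, Complex.smul_im, smul_eq_mul, Complex.mul_im, Complex.re_ofNat,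
        Complex.im_ofNat]
      ring
    unfold HasLineDerivAt
    simp only [e]
    have := (((hasDerivAt_id (0 : ℝ)).mul_const (2 * (polarized q Y X).im)).const_add
      (q X).im).add (((hasDerivAt_id (0 : ℝ)).pow 2).mul_const (q Y).im)
    simpa [Pi.add_def] using this
  have hd : DifferentiableAt ℝ (fun Z => (q Z).im) X := by
    have e : (fun Z => (q Z).im) = fun Z : Phase n => ∑ k, ∑ l, Z k * (Z l *
        (polarized q (basisVec k) (basisVec l)).im) := by
      funext Z
      rw [← polarized_self q Z, polarized_eq_sum]
      simp
    rw [e]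
    fun_prop
  rw [← hd.lineDeriv_eq_fderiv]
  exact hline.lineDeriv

theorem im_polarized_basisVec_left (q : CQuadForm n) (k : Fin n ⊕ Fin n) (X : Phase n) :
    (polarized q (basisVec k) X).im =
      ∑ l, (polarized q (basisVec k) (basisVec l)).im * X l := by
  rw [polarized_eq_sum]
  simp [basisVec, mul_comm, apply_ite]

/-- The Hamilton vector field of `Im q` is `X ↦ 2 (Im F) X`. -/
theorem hamiltonField_im (q : CQuadForm n) (g : Phase n → ℝ) (X : Phase n) :
    hamiltonField (fun Y => (q Y).im) g X = 2 * fderiv ℝ g X (imHamiltonMap q X) := by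
  have e : imHamiltonMap q X = ∑ k, imHamiltonMap q X k • basisVec k := by
    ext j
    rcases j with j | j <;> simp [basisVec, Finset.sum_apply, Pi.single_apply]
  have hinl : ∀ i : Fin n, imHamiltonMap q X (Sum.inl i) =
      (polarized q (basisVec (Sum.inr i)) X).im := fun i => by
    rw [im_polarized_basisVec_left]
    simp [imHamiltonMap, Matrix.toLpLin_apply, Matrix.mulVec, dotProduct, hamiltonMap]
  have hinr : ∀ i : Fin n, imHamiltonMap q X (Sum.inr i) =
      -(polarized q (basisVec (Sum.inl i)) X).im := fun i => by
    rw [im_polarized_basisVec_left]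
    simp [imHamiltonMap, Matrix.toLpLin_apply, Matrix.mulVec, dotProduct, hamiltonMap]
  rw [e, map_sum, Fintype.sum_sum_type, ← Finset.sum_add_distrib, Finset.mul_sum, hamiltonField]
  refine Finset.sum_congr rfl fun i _ => ?_
  rw [fderiv_im_apply, fderiv_im_apply, hinl, hinr, map_smul, map_smul, smul_eq_mul, smul_eq_mul]
  ring

theorem one_le_japaneseBracket {n : ℕ} (X : Phase n) : 1 ≤ japaneseBracket X :=
  Real.one_le_sqrt.2 (by nlinarith [sq_nonneg ‖X‖])

theorem japaneseBracket_le {n : ℕ} (X : Phase n) : japaneseBracket X ≤ 1 + ‖X‖ := by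
  rw [japaneseBracket, Real.sqrt_le_left (by positivity)]
  nlinarith [norm_nonneg X]

end QuadSys

end

theorem proposition2p0p1 {n N : ℕ} (q : Fin N → QuadSys.CQuadForm n)
    (hq : ∀ (j : Fin N) (X : QuadSys.Phase n), 0 ≤ (q j X).re)
    (m : ℕ) (hm : 1 ≤ m) (Ω₀ : Set (QuadSys.Phase n)) (hΩ₀ : IsOpen Ω₀)
    (hell : ∃ c₀ : ℝ, 0 < c₀ ∧ ∀ X ∈ Ω₀, c₀ * ‖X‖ ^ 2 ≤ QuadSys.iteratedSum q m X) :
    ∃ g : Fin N → QuadSys.Phase n → ℝ,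
      (∀ j : Fin N,
        QuadSys.IsSymbolOn Ω₀ QuadSys.japaneseBracket 0 (1 / (2 * (m : ℝ) + 1)) (g j)) ∧
      ∃ (c : ℝ) (c' : Fin N → ℝ), 0 < c ∧ (∀ j : Fin N, 0 < c' j) ∧
        ∀ X ∈ Ω₀,
          c * QuadSys.japaneseBracket X ^ (2 / (2 * (m : ℝ) + 1)) ≤
            1 + ∑ j : Fin N,
              ((q j X).re + c' j * QuadSys.hamiltonField (fun Y => (q j Y).im) (g j) X) := by
  open QuadSys in
  obtain ⟨c₀, hc₀, hell⟩ := hell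
  have hpos : ∀ k X, 0 ≤ levelForm q k X := fun k X => by
    rw [levelForm_apply]
    exact Finset.sum_nonneg fun _ _ => Finset.sum_nonneg fun j _ => hq j _
  -- `‖U k X‖²` is the part of the iterated sum with `k` factors `Im F`
  choose U hU using fun k => exists_norm_sq_eq (levelForm q k) (hpos k)
  set B : Fin N → Phase n →L[ℝ] Phase n := fun j =>
    LinearMap.toContinuousLinearMap (imHamiltonMap (q j))
  have hUB : ∀ k X, ‖U (k + 1) X‖ ^ 2 = ∑ l, ‖U k (B l X)‖ ^ 2 := fun k X => by
    simp only [hU, levelForm_succ]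
    rfl
  set K := Real.sqrt ((m + 1) / c₀) with hK
  have hK0 : 0 ≤ K := Real.sqrt_nonneg _
  have hnorm : ∀ X ∈ Ω₀, ‖X‖ ≤ K * scale m U X ^ (2 * m + 1) := fun X hX =>
    norm_le_mul_scale m U hc₀ (by simpa only [hU, ← iteratedSum_eq] using hell X hX)
  set s : ℝ := 1 / (2 * (m : ℝ) + 1) with hs
  have hs0 : 0 < s := by positivity
  set D : ℝ := (1 + K) ^ s with hD
  have hD0 : 0 < D := by positivity
  have hbr : ∀ X ∈ Ω₀, japaneseBracket X ^ s ≤ D * scale m U X := by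
    intro X hX
    have hr := one_le_scale m U X
    have h1 : japaneseBracket X ≤ (1 + K) * scale m U X ^ (2 * m + 1) := by
      have := one_le_pow₀ hr (n := 2 * m + 1)
      have := hnorm X hX
      have := japaneseBracket_le X
      linarith
    have h2 : (scale m U X ^ (2 * m + 1)) ^ s = scale m U X := by
      rw [hs, one_div, show (2 * (m : ℝ) + 1) = ((2 * m + 1 : ℕ) : ℝ) by push_cast; ring]
      exact Real.pow_rpow_inv_natCast (by linarith) (by omega)
    have h0 := one_le_japaneseBracket X
    calc japaneseBracket X ^ s ≤ ((1 + K) * scale m U X ^ (2 * m + 1)) ^ s :=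
          Real.rpow_le_rpow (by linarith) h1 hs0.le
      _ = D * scale m U X := by rw [Real.mul_rpow (by positivity) (by positivity), h2]
  obtain ⟨ε, c, hc, hε, hlow⟩ := exists_lower_bound m U B hUB hK0
  have hsm : ∀ (j : Fin N) (k : ℕ),
      ContDiff ℝ ∞ fun X => ε (k + 1) * multiplier m U k ((U k).comp (B j)) X := fun j k =>
    contDiff_const.mul (contDiff_multiplier m U k _)
  -- the constants `1 / 2` compensate `H_{Im q_j} g (X) = 2 dg(X) (Im F_j X)`
  refine ⟨fun j X => ∑ k ∈ Finset.range m, ε (k + 1) * multiplier m U k ((U k).comp (B j)) X,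
    fun j => ⟨(ContDiff.sum fun k _ => hsm j k).contDiffOn, fun i => ?_⟩,
    c / D ^ 2, fun _ => 1 / 2, by positivity, fun _ => by norm_num, fun X hX => ?_⟩
  · have hex : ∀ k : Fin m, ∃ C : ℝ, 0 < C ∧ ∀ X,
        ‖iteratedFDeriv ℝ i (multiplier m U k ((U k).comp (B j))) X‖ ≤
          C * (scale m U X)⁻¹ ^ i := fun k => by
      refine norm_iteratedFDeriv_multiplier_le k.2 U _ (fun X => ?_) i
      refine le_of_sq_le_sq ?_ (norm_nonneg _)
      rw [hUB]
      exact Finset.single_le_sum (f := fun l => ‖U k (B l X)‖ ^ 2) (fun _ _ => by positivity)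
        (Finset.mem_univ j)
    choose C hC0 hC using hex
    have hS : 0 ≤ ∑ k : Fin m, ε (k + 1) * C k :=
      Finset.sum_nonneg fun k _ => mul_nonneg (hε _).le (hC0 k).le
    refine ⟨(∑ k : Fin m, ε (k + 1) * C k) * D ^ i + 1, by positivity, fun X hX => ?_⟩
    have hr := one_le_scale m U X
    have hJ : 0 < japaneseBracket X := by linarith [one_le_japaneseBracket X]
    have hJs : 0 < japaneseBracket X ^ s := Real.rpow_pos_of_pos hJ _
    -- each factor `ρ⁻¹` is a gain of `⟨X⟩ ^ (-1 / (2m+1))`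
    have hgain : (scale m U X)⁻¹ ^ i ≤ D ^ i * japaneseBracket X ^ (0 - s * (i : ℝ)) := by
      rw [zero_sub, Real.rpow_neg hJ.le, Real.rpow_mul hJ.le, Real.rpow_natCast, ← inv_pow,
        ← mul_pow]
      refine pow_le_pow_left₀ (by positivity) ?_ i
      rw [← div_eq_mul_inv, le_div_iff₀ hJs, inv_mul_le_iff₀ (by positivity), mul_comm]
      exact hbr X hX
    rw [iteratedFDeriv_sum fun k _ => (hsm j k).of_le (by exact_mod_cast le_top),
      Finset.sum_apply, Finset.sum_range]
    calc ‖∑ k : Fin m, iteratedFDeriv ℝ i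
            (fun X => ε (k + 1) * multiplier m U k ((U k).comp (B j)) X) X‖
        ≤ ∑ k : Fin m, ε (k + 1) * C k * (scale m U X)⁻¹ ^ i := by
          refine (norm_sum_le _ _).trans (Finset.sum_le_sum fun k _ => ?_)
          have h := iteratedFDeriv_const_smul_apply (𝕜 := ℝ) (a := ε (k + 1)) (i := i) (x := X)
            (((contDiff_multiplier m U k ((U k).comp (B j))).of_le
              (by exact_mod_cast le_top)).contDiffAt)
          have h' : iteratedFDeriv ℝ i
              (fun X => ε (k + 1) * multiplier m U k ((U k).comp (B j)) X) X = _ := h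
          rw [h', norm_smul, Real.norm_of_nonneg (hε _).le, mul_assoc]
          exact mul_le_mul_of_nonneg_left (hC k X) (hε _).le
      _ = (∑ k : Fin m, ε (k + 1) * C k) * (scale m U X)⁻¹ ^ i := by rw [Finset.sum_mul]
      _ ≤ (∑ k : Fin m, ε (k + 1) * C k) * (D ^ i * japaneseBracket X ^ (0 - s * (i : ℝ))) := by
          gcongr
      _ ≤ _ := by
          rw [← mul_assoc]
          gcongr
          linarith
  · have hJ : 0 < japaneseBracket X := by linarith [one_le_japaneseBracket X]
    have hsq : japaneseBracket X ^ (2 / (2 * (m : ℝ) + 1)) = (japaneseBracket X ^ s) ^ 2 := by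
      rw [← Real.rpow_natCast, ← Real.rpow_mul hJ.le, hs]
      congr 1
      push_cast
      ring
    have hfd : ∀ j : Fin N, fderiv ℝ (fun X => ∑ k ∈ Finset.range m,
        ε (k + 1) * multiplier m U k ((U k).comp (B j)) X) X (imHamiltonMap (q j) X) =
        ∑ k ∈ Finset.range m,
          ε (k + 1) * fderiv ℝ (multiplier m U k ((U k).comp (B j))) X (B j X) := fun j => by
      have hd : ∀ k, DifferentiableAt ℝ (multiplier m U k ((U k).comp (B j))) X := fun k =>
        (contDiff_multiplier m U k _).differentiable (by simp) X
      rw [fderiv_fun_sum fun k _ => (hd k).const_mul _, sum_apply]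
      refine Finset.sum_congr rfl fun k _ => ?_
      rw [fderiv_const_mul (hd k)]
      rfl
    calc c / D ^ 2 * japaneseBracket X ^ (2 / (2 * (m : ℝ) + 1))
        ≤ c / D ^ 2 * (D * scale m U X) ^ 2 := by
          rw [hsq]
          gcongr
          exact hbr X hX
      _ = c * scale m U X ^ 2 := by
          field_simp
      _ ≤ _ := hlow X (hnorm X hX)
      _ = _ := by
          rw [hU, levelForm_zero, ← Finset.sum_add_distrib]
          congr 1
          refine Finset.sum_congr rfl fun j _ => ?_
          rw [hamiltonField_im, hfd]
          ring
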